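/- Let $m\ge 0$ be an integer, let $\lambda>m/2$ be real, let $\mu_1,\dots,\mu_m>0$ and $\mu_0=1$, and put $2\lambda_j=2\lambda-m+2j$ for $0\le j\le m$. For $\nu>0$ let $A^{(\nu)}(\mathbb D)$ be the Hilbert space of holomorphic functions on the open unit disc $\mathbb D$ with reproducing kernel $(1-z\bar\omega)^{-2\nu}$; equivalently, the functions $\sqrt{(2\nu)_n/n!}\,z^n$, $n\ge 0$, form an orthonormal basis, where $(x)_n=x(x+1)\cdots(x+n-1)$. For $f\in A^{(\lambda_j)}(\mathbb D)$ let $\Gamma_jf:\mathbb D\to\mathbb C^{m+1}$ be the function with components, for $0\le \ell\le m$, $$(\Gamma_jf)_\ell=\binom{\ell}{j}\frac{1}{(2\lambda_j)_{\ell-j}}\,f^{(\ell-j)}\ \text{ if } \ell\ge j,\qquad (\Gamma_jf)_\ell=0\ \text{ if } \ell<j.$$ The map $(f_0,\dots,f_m)\mapsto\sum_{j=0}^m\mu_j\Gamma_jf_j$ on $\bigoplus_{j=0}^m A^{(\lambda_j)}(\mathbb D)$ is injective. Let $\mathbf A^{(\lambda,\mu)}(\mathbb D)$ be its image, with the Hilbert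 space structure that makes this map unitary from the orthogonal direct sum. It is a reproducing kernel Hilbert space of $\mathbb C^{m+1}$-valued holomorphic functions on $\mathbb D$, with kernel $\sum_j\mu_j^2\mathbf B^{(\lambda_j)}$, where $\mathbf B^{(\lambda_j)}$ is the kernel of the image of $\Gamma_j$ with the inner product transferred from $A^{(\lambda_j)}(\mathbb D)$. Then the multiplication operator $M^{(\lambda,\mu)}$, $(M^{(\lambda,\mu)}f)(z)=zf(z)$, is a well-defined bounded operator on $\mathbf A^{(\lambda,\mu)}(\mathbb D)$, and it is irreducible: if $N$ is a closed subspace such that $N$ and $N^\perp$ are both invariant under $M^{(\lambda,\mu)}$, then $N=\{0\}$ or $N=\mathbf A^{(\lambda,\mu)}(\mathbb D)$. -/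

import Mathlib

noncomputable section

open scoped ComplexConjugate Complex.UnitDisc InnerProductSpace

namespace KoranyiMisra

/-- `√((2λ)ₙ / n!)`, where `(x)ₙ` is the rising Pochhammer symbol. -/
def weight (lam : ℝ) (n : ℕ) : ℝ :=
  √((ascPochhammer ℝ n).eval (2 * lam) / (n.factorial : ℝ))

theorem weight_sq {lam : ℝ} (h : 0 < lam) (n : ℕ) :
    weight lam n ^ 2 = (ascPochhammer ℝ n).eval (2 * lam) / (n.factorial : ℝ) :=
  Real.sq_sqrt (div_nonneg (ascPochhammer_pos n _ (by positivity)).le (by positivity))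

theorem weight_pos {lam : ℝ} (h : 0 < lam) (n : ℕ) : 0 < weight lam n :=
  Real.sqrt_pos.2 (div_pos (ascPochhammer_pos n _ (by positivity)) (by positivity))

theorem hasSum_weight {lam : ℝ} (h : 0 < lam) {z : ℂ} (hz : ‖z‖ < 1) :
    HasSum (fun n => (weight lam n : ℂ) ^ 2 * z ^ n) ((1 - z) ^ (-(2 * lam : ℝ) : ℂ)) := by
  have h1 := (Complex.one_div_one_sub_cpow_hasFPowerSeriesOnBall_zero
    ((2 * lam : ℝ) : ℂ)).hasSum (y := z)
      (by simpa [Metric.mem_eball, edist_zero_right, ← ofReal_norm] using hz)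
  rw [zero_add] at h1
  rw [Complex.cpow_neg, ← one_div]
  refine h1.congr_fun fun n => ?_
  rw [FormalMultilinearSeries.ofScalars_apply_eq, smul_eq_mul]
  congr 1
  have h2 := Ring.factorial_nsmul_multichoose_eq_ascPochhammer ((2 * lam : ℝ) : ℂ) n
  rw [Polynomial.ascPochhammer_smeval_eq_eval, nsmul_eq_mul] at h2
  have h3 : (n.factorial : ℂ) ≠ 0 := by exact_mod_cast n.factorial_ne_zero
  rw [← Complex.ofReal_pow, weight_sq h, Ring.choose,
    show ((2 * lam : ℝ) : ℂ) + n - 1 - n + 1 = ((2 * lam : ℝ) : ℂ) by ring,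
    Complex.ofReal_div, Complex.ofReal_natCast, div_eq_iff h3,
    mul_comm (Ring.multichoose _ _), h2]
  have := Polynomial.eval₂_at_apply (p := ascPochhammer ℝ n) Complex.ofRealHom (2 * lam)
  rw [Polynomial.eval₂_eq_eval_map, ascPochhammer_map] at this
  exact this.symm

/-- The Hilbert space `A^{(λ)}(𝔻)`, `λ > 0`: an element is a holomorphic function
`f = ∑ₙ aₙ √((2λ)ₙ / n!) zⁿ` with `(aₙ)` square summable, and the inner product is the one
for which the functions `√((2λ)ₙ / n!) zⁿ` form an orthonormal basis. -/
def Berg (lam : ℝ) (_ : 0 < lam) : Type := lp (fun _ : ℕ => ℂ) 2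

namespace Berg

variable {lam : ℝ} {h : 0 < lam}

instance : NormedAddCommGroup (Berg lam h) :=
  inferInstanceAs (NormedAddCommGroup (lp (fun _ : ℕ => ℂ) 2))

instance : InnerProductSpace ℂ (Berg lam h) :=
  inferInstanceAs (InnerProductSpace ℂ (lp (fun _ : ℕ => ℂ) 2))

instance : CompleteSpace (Berg lam h) :=
  inferInstanceAs (CompleteSpace (lp (fun _ : ℕ => ℂ) 2))

/-- The coordinates of `f` in the orthonormal basis `√((2λ)ₙ / n!) zⁿ`. -/
def coord (f : Berg lam h) (n : ℕ) : ℂ := (show lp (fun _ : ℕ => ℂ) 2 from f) n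

/-- The function `f` on the open unit disc. -/
def fn (f : Berg lam h) (z : ℂ) : ℂ := ∑' n, (weight lam n : ℂ) * coord f n * z ^ n

theorem memlp_ker {z : ℂ} (h : 0 < lam) (hz : ‖z‖ < 1) :
    Memℓp (fun n => (weight lam n : ℂ) * conj z ^ n) 2 := by
  have h1 := (hasSum_weight h (z := z * conj z)
    (by simp only [norm_mul, RCLike.norm_conj]; nlinarith [norm_nonneg z])).summable.norm
  refine memℓp_gen (h1.congr fun n => ?_)
  simp [mul_pow, ← pow_mul, mul_comm]
  ring

/-- The kernel vector at `z`. -/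
def ker (h : 0 < lam) {z : ℂ} (hz : ‖z‖ < 1) : Berg lam h :=
  show lp (fun _ : ℕ => ℂ) 2 from ⟨_, memlp_ker h hz⟩

theorem hasSum_fn (f : Berg lam h) {z : ℂ} (hz : ‖z‖ < 1) :
    HasSum (fun n => (weight lam n : ℂ) * coord f n * z ^ n) ⟪ker h hz, f⟫_ℂ := by
  refine (lp.hasSum_inner (𝕜 := ℂ) (show lp (fun _ : ℕ => ℂ) 2 from ker h hz)
    (show lp (fun _ : ℕ => ℂ) 2 from f)).congr_fun fun n => ?_
  change _ = (coord f n) * conj ((weight lam n : ℂ) * conj z ^ n)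
  simp
  ring

theorem fn_eq_inner (f : Berg lam h) {z : ℂ} (hz : ‖z‖ < 1) : fn f z = ⟪ker h hz, f⟫_ℂ :=
  (hasSum_fn f hz).tsum_eq

theorem norm_ker_le {z : ℂ} {r : ℝ} (hz : ‖z‖ ≤ r) (hr : r < 1) :
    ‖ker h (hz.trans_lt hr)‖ ≤
      ‖ker h (z := (r : ℂ)) (by simpa [abs_of_nonneg ((norm_nonneg z).trans hz)] using hr)‖ := by
  have hr0 := (norm_nonneg z).trans hz
  refine lp.norm_mono (p := 2) (by norm_num) (x := (show lp (fun _ : ℕ => ℂ) 2 from ker h _))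
    (y := (show lp (fun _ : ℕ => ℂ) 2 from ker h _)) fun n => ?_
  change ‖(weight lam n : ℂ) * conj z ^ n‖ ≤ ‖(weight lam n : ℂ) * conj (r : ℂ) ^ n‖
  simp only [norm_mul, norm_pow, RCLike.norm_conj, Complex.norm_real, Real.norm_eq_abs,
    abs_of_nonneg hr0]
  gcongr

theorem differentiableOn_fn (f : Berg lam h) :
    DifferentiableOn ℂ (fn f) (Metric.ball 0 1) := by
  intro z hz
  rw [mem_ball_zero_iff] at hz
  obtain ⟨r, hzr, hr⟩ := exists_between hz
  have hr0 := (norm_nonneg z).trans hzr.le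
  have h1 := (hasSum_fn f (z := (r : ℂ)) (by simpa [abs_of_nonneg hr0] using hr)).summable.norm
  have h2 := Complex.differentiableOn_tsum_of_summable_norm (U := Metric.ball (0 : ℂ) r)
    (F := fun n (w : ℂ) => (weight lam n : ℂ) * coord f n * w ^ n) h1
    (fun n => by fun_prop) Metric.isOpen_ball (fun n w hw => by
      rw [mem_ball_zero_iff] at hw
      simp only [norm_mul, norm_pow, Complex.norm_real, Real.norm_eq_abs, abs_of_nonneg hr0]
      gcongr)
  exact (h2.differentiableAt
    (Metric.isOpen_ball.mem_nhds (by simpa using hzr))).differentiableWithinAt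

theorem exists_bound (lam : ℝ) (h : 0 < lam) (k : ℕ) {z : ℂ} (hz : ‖z‖ < 1) :
    ∃ C : ℝ, ∀ f : Berg lam h, ‖iteratedDeriv k (fn f) z‖ ≤ C * ‖f‖ := by
  obtain ⟨r, hzr, hr⟩ := exists_between hz
  have hr0 := (norm_nonneg z).trans hzr.le
  have hr' : ‖(r : ℂ)‖ < 1 := by simpa [abs_of_nonneg hr0] using hr
  have hsub : ∀ w ∈ Metric.closedBall z (r - ‖z‖), ‖w‖ ≤ r := fun w hw => by
    rw [mem_closedBall_iff_norm] at hw
    linarith [norm_le_norm_add_norm_sub' w z]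
  refine ⟨k.factorial * ‖ker h hr'‖ / (r - ‖z‖) ^ k, fun f => ?_⟩
  refine (Complex.norm_iteratedDeriv_le_of_forall_mem_sphere_norm_le k (sub_pos.2 hzr)
    (C := ‖ker h hr'‖ * ‖f‖) ?_ fun w hw => ?_).trans_eq (by ring)
  · refine DifferentiableOn.diffContOnCl_ball (U := Metric.ball 0 1) (differentiableOn_fn f) ?_
    exact fun w hw => by simpa using (hsub w hw).trans_lt hr
  · have hw' := hsub w (Metric.sphere_subset_closedBall hw)
    rw [fn_eq_inner f (hw'.trans_lt hr)]
    exact (norm_inner_le_norm _ _).trans (by gcongr; exact norm_ker_le hw' hr)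

theorem fn_add (f g : Berg lam h) {z : ℂ} (hz : ‖z‖ < 1) : fn (f + g) z = fn f z + fn g z := by
  simp [fn_eq_inner _ hz]

theorem fn_smul (c : ℂ) (f : Berg lam h) {z : ℂ} (hz : ‖z‖ < 1) :
    fn (c • f) z = c * fn f z := by
  simp [fn_eq_inner _ hz]

theorem contDiffAt_fn (f : Berg lam h) (k : ℕ) {z : ℂ} (hz : ‖z‖ < 1) :
    ContDiffAt ℂ k (fn f) z :=
  ((differentiableOn_fn f).contDiffOn Metric.isOpen_ball).contDiffAt
    (Metric.isOpen_ball.mem_nhds (by simpa using hz))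

/-- The functional `f ↦ f⁽ᵏ⁾(z)`, for `z` in the open unit disc. -/
def derivCLM (lam : ℝ) (h : 0 < lam) (k : ℕ) (z : 𝔻) : Berg lam h →L[ℂ] ℂ :=
  LinearMap.mkContinuousOfExistsBound
    { toFun := fun f => iteratedDeriv k (fn f) z
      map_add' := fun f g => by
        rw [← iteratedDeriv_fun_add (contDiffAt_fn f k z.norm_lt_one)
          (contDiffAt_fn g k z.norm_lt_one)]
        refine Filter.EventuallyEq.iteratedDeriv_eq k ?_
        filter_upwards [Metric.isOpen_ball.mem_nhds (mem_ball_zero_iff.2 z.norm_lt_one)] with w hw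
        exact fn_add f g (mem_ball_zero_iff.1 hw)
      map_smul' := fun c f => by
        rw [RingHom.id_apply, smul_eq_mul,
          ← iteratedDeriv_const_mul c (contDiffAt_fn f k z.norm_lt_one)]
        refine Filter.EventuallyEq.iteratedDeriv_eq k ?_
        filter_upwards [Metric.isOpen_ball.mem_nhds (mem_ball_zero_iff.2 z.norm_lt_one)] with w hw
        exact fn_smul c f (mem_ball_zero_iff.1 hw) }
    (exists_bound lam h k z.norm_lt_one)

@[simp]
theorem derivCLM_apply (k : ℕ) (z : 𝔻) (f : Berg lam h) :
    derivCLM lam h k z f = iteratedDeriv k (fn f) z := rfl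

theorem eq_zero_of_fn (f : Berg lam h) (hf : ∀ z : 𝔻, fn f z = 0) : f = 0 := by
  have hball : ∀ {y : ℂ}, y ∈ Metric.eball (0 : ℂ) (2⁻¹ : NNReal) → ‖y‖ < 1 := fun {y} hy => by
    rw [Metric.eball_coe, mem_ball_zero_iff] at hy
    refine hy.trans ?_
    norm_num
  have hp : HasFPowerSeriesOnBall (fn f) (FormalMultilinearSeries.ofScalars ℂ
      fun n => (weight lam n : ℂ) * coord f n) 0 (2⁻¹ : NNReal) :=
    { r_le := by
        refine FormalMultilinearSeries.le_radius_of_summable_norm _ ?_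
        refine (hasSum_fn f (z := (2⁻¹ : ℂ)) (by norm_num)).summable.norm.congr fun n => ?_
        simp
      r_pos := by simp
      hasSum := fun {y} hy => by
        have := hasSum_fn f (hball hy)
        rw [← fn_eq_inner] at this
        rw [zero_add]
        refine this.congr_fun fun n => ?_
        rw [FormalMultilinearSeries.ofScalars_apply_eq, smul_eq_mul] }
  have h0 := (hp.congr (g := 0) fun y hy => hf ⟨y, by simpa using hball hy⟩).hasFPowerSeriesAt
  have h1 := h0.eq_zero
  refine lp.ext (E := fun _ : ℕ => ℂ) (p := 2) (funext fun n => ?_)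
  have h2 := congrArg (fun q => q.coeff n) h1
  simp only [FormalMultilinearSeries.coeff_ofScalars] at h2
  have h3 : (weight lam n : ℂ) ≠ 0 := by exact_mod_cast (weight_pos h n).ne'
  exact (mul_eq_zero.1 h2).resolve_left h3

/-- `A^{(λ)}(𝔻)` as a reproducing kernel Hilbert space of functions on the unit disc. -/
instance : RKHS ℂ (Berg lam h) 𝔻 ℂ where
  coeCLM := .pi fun z => derivCLM lam h 0 z
  coeCLM_injective := (injective_iff_map_eq_zero _).2 fun f hf =>
    eq_zero_of_fn f fun z => by simpa using congrFun hf z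

theorem coe_eq_fn (f : Berg lam h) (z : 𝔻) : f z = fn f z := by
  change iteratedDeriv 0 (fn f) z = _
  simp

/-- The reproducing kernel of `A^{(λ)}(𝔻)` is `(1 - z ω̄)^{-2λ}`. -/
theorem kernel_apply (z w : 𝔻) (v : ℂ) :
    RKHS.kernel (Berg lam h) z w v = (1 - (z : ℂ) * conj (w : ℂ)) ^ (-(2 * lam : ℝ) : ℂ) * v := by
  have h1 : RKHS.kerFun (Berg lam h) w v = v • ker h w.norm_lt_one := by
    refine ext_inner_right ℂ fun f => ?_
    rw [RKHS.kerFun_inner, coe_eq_fn, inner_smul_left, fn_eq_inner f w.norm_lt_one]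
    simp [mul_comm]
  rw [← RKHS.kerFun_apply, h1, coe_eq_fn, fn_smul _ _ z.norm_lt_one, mul_comm]
  congr 1
  have h2 : ‖(z : ℂ) * conj (w : ℂ)‖ < 1 := by
    rw [norm_mul, RCLike.norm_conj]
    nlinarith [norm_nonneg (z : ℂ), norm_nonneg (w : ℂ), z.norm_lt_one, w.norm_lt_one]
  rw [← (hasSum_weight h h2).tsum_eq]
  refine tsum_congr fun n => ?_
  change (weight lam n : ℂ) * ((weight lam n : ℂ) * conj (w : ℂ) ^ n) * (z : ℂ) ^ n = _
  ring

end Berg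

/-- `λ_j`, given by `2λ_j = 2λ - m + 2j`. -/
def lamj (m : ℕ) (lam : ℝ) (j : Fin (m + 1)) : ℝ := lam - m / 2 + (j : ℕ)

theorem lamj_pos {m : ℕ} {lam : ℝ} (hlam : (m : ℝ) / 2 < lam) (j : Fin (m + 1)) :
    0 < lamj m lam j := by
  have : (0 : ℝ) ≤ (j : ℕ) := by positivity
  unfold lamj
  linarith

/-- The map `f ↦ (Γ_j f)(z)`, `A^{(λ_j)}(𝔻) → ℂ^{m+1}`, for `z ∈ 𝔻`. -/
def Gam {m : ℕ} {lam : ℝ} (hlam : (m : ℝ) / 2 < lam) (j : Fin (m + 1)) (z : 𝔻) :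
    Berg (lamj m lam j) (lamj_pos hlam j) →L[ℂ] EuclideanSpace ℂ (Fin (m + 1)) :=
  (EuclideanSpace.equiv (Fin (m + 1)) ℂ).symm.toContinuousLinearMap ∘L
    .pi fun l : Fin (m + 1) =>
      if j ≤ l then
        (((l : ℕ).choose j : ℂ) /
            (((ascPochhammer ℝ ((l : ℕ) - j)).eval (2 * lamj m lam j) : ℝ) : ℂ)) •
          Berg.derivCLM (lamj m lam j) (lamj_pos hlam j) ((l : ℕ) - j) z
      else 0

theorem Gam_apply {m : ℕ} {lam : ℝ} (hlam : (m : ℝ) / 2 < lam) (j : Fin (m + 1)) (z : 𝔻)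
    (f : Berg (lamj m lam j) (lamj_pos hlam j)) (l : Fin (m + 1)) :
    Gam hlam j z f l =
      if j ≤ l then
        ((l : ℕ).choose j : ℂ) /
            (((ascPochhammer ℝ ((l : ℕ) - j)).eval (2 * lamj m lam j) : ℝ) : ℂ) *
          iteratedDeriv ((l : ℕ) - j) f.fn z
      else 0 := by
  simp only [Gam]
  split_ifs with hjl <;> simp [hjl]

/-- The Hilbert space `A^{(λ,μ)}(𝔻)`: its elements are the functions `∑_j μ_j Γ_j f_j` with
`f_j ∈ A^{(λ_j)}(𝔻)`, and its inner product is the one for which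
`(f_j)_j ↦ ∑_j μ_j Γ_j f_j` is unitary from the Hilbert space direct sum of the `A^{(λ_j)}(𝔻)`. -/
def ASpace (m : ℕ) (lam : ℝ) (mu : Fin (m + 1) → ℝ) (hlam : (m : ℝ) / 2 < lam)
    (_ : ∀ j, 0 < mu j) : Type :=
  PiLp 2 fun j : Fin (m + 1) => Berg (lamj m lam j) (lamj_pos hlam j)

namespace ASpace

variable {m : ℕ} {lam : ℝ} {mu : Fin (m + 1) → ℝ} {hlam : (m : ℝ) / 2 < lam}
  {hmu : ∀ j, 0 < mu j}

instance : NormedAddCommGroup (ASpace m lam mu hlam hmu) :=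
  inferInstanceAs (NormedAddCommGroup
    (PiLp 2 fun j : Fin (m + 1) => Berg (lamj m lam j) (lamj_pos hlam j)))

instance : InnerProductSpace ℂ (ASpace m lam mu hlam hmu) :=
  inferInstanceAs (InnerProductSpace ℂ
    (PiLp 2 fun j : Fin (m + 1) => Berg (lamj m lam j) (lamj_pos hlam j)))

instance : CompleteSpace (ASpace m lam mu hlam hmu) :=
  inferInstanceAs (CompleteSpace
    (PiLp 2 fun j : Fin (m + 1) => Berg (lamj m lam j) (lamj_pos hlam j)))

/-- The component `f_j` of `∑_j μ_j Γ_j f_j`. -/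
def comp (j : Fin (m + 1)) :
    ASpace m lam mu hlam hmu →L[ℂ] Berg (lamj m lam j) (lamj_pos hlam j) :=
  PiLp.proj 2 (fun j : Fin (m + 1) => Berg (lamj m lam j) (lamj_pos hlam j)) j

/-- The value at `z` of the function `∑_j μ_j Γ_j f_j`. -/
def eval (z : 𝔻) : ASpace m lam mu hlam hmu →L[ℂ] EuclideanSpace ℂ (Fin (m + 1)) :=
  ∑ j, (mu j : ℂ) • (Gam hlam j z ∘L comp j)

theorem eq_zero_of_eval (f : ASpace m lam mu hlam hmu) (hf : ∀ z, eval z f = 0) : f = 0 := by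
  have key : ∀ (n : ℕ) (l : Fin (m + 1)), (l : ℕ) = n → comp l f = 0 := by
    intro n
    induction n using Nat.strong_induction_on with
    | _ n ih =>
      intro l hl
      refine Berg.eq_zero_of_fn _ fun z => ?_
      have h1 := congrArg (fun v : EuclideanSpace ℂ (Fin (m + 1)) => v l) (hf z)
      simp only [eval, FunLike.coe_sum, Finset.sum_apply, FunLike.coe_smul, Pi.smul_apply,
        ContinuousLinearMap.comp_apply, WithLp.ofLp_sum, WithLp.ofLp_smul, smul_eq_mul,
        PiLp.zero_apply] at h1
      rw [Finset.sum_eq_single l] at h1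
      · rw [Gam_apply] at h1
        have h2 : (mu l : ℂ) ≠ 0 := by exact_mod_cast (hmu l).ne'
        simpa [h2] using h1
      · intro j _ hjl
        rcases lt_or_gt_of_ne hjl with hlt | hlt
        · rw [ih j (by omega) j rfl]
          simp
        · rw [Gam_apply, if_neg (not_le.2 hlt), mul_zero]
      · simp
  exact PiLp.ext fun j => key j j rfl

/-- `A^{(λ,μ)}(𝔻)` as a reproducing kernel Hilbert space of `ℂ^{m+1}`-valued functions on `𝔻`. -/
instance : RKHS ℂ (ASpace m lam mu hlam hmu) 𝔻 (EuclideanSpace ℂ (Fin (m + 1))) where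
  coeCLM := .pi eval
  coeCLM_injective := (injective_iff_map_eq_zero _).2 fun f hf =>
    eq_zero_of_eval f fun z => congrFun hf z

theorem coe_apply (f : ASpace m lam mu hlam hmu) (z : 𝔻) :
    f z = ∑ j, (mu j : ℂ) • Gam hlam j z (comp j f) := by
  change eval z f = _
  simp [eval]

end ASpace

/-- A closed subspace `N` reduces `T` if `N` and its orthogonal complement are `T`-invariant. -/
def IsReducing {H : Type*} [NormedAddCommGroup H] [InnerProductSpace ℂ H]
    (T : H →L[ℂ] H) (N : Submodule ℂ H) : Prop :=
  IsClosed (N : Set H) ∧ (∀ f ∈ N, T f ∈ N) ∧ ∀ f ∈ Nᗮ, T f ∈ Nᗮ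

/-- A bounded operator on a nonzero Hilbert space is irreducible if its only reducing subspaces
are `0` and the whole space. -/
def IsIrreducibleOp {H : Type*} [NormedAddCommGroup H] [InnerProductSpace ℂ H]
    (T : H →L[ℂ] H) : Prop :=
  Nontrivial H ∧ ∀ N : Submodule ℂ H, IsReducing T N → N = ⊥ ∨ N = ⊤

end KoranyiMisra

end

/-!
A subspace `N` reduces multiplication by `z` exactly when its orthogonal projection commutes with
`M`, hence also with `M*`. Since `M*` lowers degrees, it acts nilpotently on polynomials, and
conversely every vector killed by a power of `M*` is a polynomial; so the projection onto `N` maps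
polynomials to polynomials, and a nonzero reducing subspace contains a nonzero polynomial. If both
`N` and `Nᗮ` are nonzero, one obtains nonzero polynomials `u`, `v` all of whose multiples `z^k u`
and `z^n v` are orthogonal. This is impossible, because the inner products of `z^{p + n} e_l` and
`z^{q + n} e_r` in a common degree are asymptotic to `g l r / (ρ n * n ^ (l + r))` for one
sequence `ρ` and nonzero constants `g l r`, so that the terms with the least `l` and `r` dominate.

The coordinates `f_j` of `∑_j Γ_j f_j` are recovered by inverting a triangular matrix of
coefficients of derivatives. Its inverse is explicit and has entries of alternating sign, whence
the nonvanishing of `g`. It also shows that multiplication by `z` acts on the coordinates by `z`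
plus a strictly lower triangular matrix of differential operators, in which `D^d` maps
`A^{(λ)}(𝔻)` into `A^{(λ + d)}(𝔻)`.
-/

noncomputable section

open Filter Topology
open scoped ComplexConjugate Complex.UnitDisc InnerProductSpace

namespace KoranyiMisra

theorem exists_multiplicationCLM {𝕜 X V H : Type*} [RCLike 𝕜] [NormedAddCommGroup V]
    [InnerProductSpace 𝕜 V] [NormedAddCommGroup H] [InnerProductSpace 𝕜 H] [CompleteSpace H]
    [RKHS 𝕜 H X V] (φ : X → 𝕜) (hφ : ∀ f : H, ∃ g : H, ∀ x, g x = φ x • f x) :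
    ∃ M : H →L[𝕜] H, ∀ f x, M f x = φ x • f x := by
  choose T hT using hφ
  let L : H →ₗ[𝕜] H :=
    { toFun := T
      map_add' := fun f g => RKHS.ext fun x => by simp [hT]
      map_smul' := fun c f => RKHS.ext fun x => by simp [hT, smul_comm c] }
  refine ⟨.ofSeqClosedGraph (g := L) fun u f g hu hLu => RKHS.ext fun x => ?_, hT⟩
  have hg : Tendsto (fun n => T (u n) x) atTop (𝓝 (g x)) :=
    ((RKHS.continuous_eval x).tendsto g).comp hLu
  have hf : Tendsto (fun n => φ x • u n x) atTop (𝓝 (φ x • f x)) :=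
    (((RKHS.continuous_eval x).tendsto f).comp hu).const_smul _
  simp only [← hT] at hf
  exact tendsto_nhds_unique hg hf

section Reducing

variable {H : Type*} [NormedAddCommGroup H] [InnerProductSpace ℂ H]
  {T : H →L[ℂ] H} {N : Submodule ℂ H}

theorem IsReducing.pow_mem (hN : IsReducing T N) {f : H} (hf : f ∈ N) (n : ℕ) :
    (T ^ n) f ∈ N := by
  induction n with
  | zero => exact hf
  | succ n ih =>
    rw [pow_succ']
    exact hN.2.1 _ ih

theorem IsReducing.commute_starProjection [N.HasOrthogonalProjection] (hN : IsReducing T N) :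
    Commute T N.starProjection := by
  ext f
  refine (Submodule.eq_starProjection_of_mem_orthogonal
    (hN.2.1 _ (N.starProjection_apply_mem f)) ?_).symm
  rw [ContinuousLinearMap.coe_coe, ← map_sub]
  exact hN.2.2 _ (N.sub_starProjection_mem_orthogonal f)

variable [CompleteSpace H]

theorem IsReducing.orthogonal (hN : IsReducing T N) : IsReducing T Nᗮ := by
  refine ⟨N.isClosed_orthogonal, hN.2.2, ?_⟩
  rw [N.orthogonal_orthogonal_eq_closure, hN.1.submodule_topologicalClosure_eq]
  exact hN.2.1

theorem IsReducing.commute_adjoint_starProjection [N.HasOrthogonalProjection]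
    (hN : IsReducing T N) : Commute T.adjoint N.starProjection := by
  simpa only [← ContinuousLinearMap.star_eq_adjoint, isSelfAdjoint_starProjection N |>.star_eq]
    using hN.commute_starProjection.star_star

end Reducing

/-- Vectors `E p l`, modelled on the functions `zᵖ e_l` with values in `ℂᵈ`, on which `T` acts like
multiplication by `z`. The family is total, and `p + l` is a degree: vectors of different degrees
are orthogonal. -/
structure IsMonomialFamily {H : Type*} [NormedAddCommGroup H] [InnerProductSpace ℂ H]
    (T : H →L[ℂ] H) {d : ℕ} (E : ℕ → Fin d → H) : Prop where
  map_eq (p : ℕ) (l : Fin d) : T (E p l) = E (p + 1) l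
  inner_eq_zero {p q : ℕ} {l r : Fin d} (h : p + l ≠ q + r) : ⟪E p l, E q r⟫_ℂ = 0
  eq_zero_of_inner (f : H) (hf : ∀ p l, ⟪E p l, f⟫_ℂ = 0) : f = 0

/-- The inner product of two vectors `E p l`, `E q r` of the same degree is asymptotic to
`g l r / (ρ n * n ^ (l + r))` when both `p` and `q` are shifted by a large `n`. -/
def HasGramLimit {H : Type*} [NormedAddCommGroup H] [InnerProductSpace ℂ H] {d : ℕ}
    (E : ℕ → Fin d → H) (ρ : ℕ → ℂ) (g : Fin d → Fin d → ℂ) : Prop :=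
  ∀ ⦃p q : ℕ⦄ ⦃l r : Fin d⦄, p + l = q + r →
    Tendsto (fun n : ℕ => ρ n * (n : ℂ) ^ (l + r : ℕ) * ⟪E (p + n) l, E (q + n) r⟫_ℂ) atTop
      (𝓝 (g l r))

section MonomialFamily

variable {H : Type*} [NormedAddCommGroup H] [InnerProductSpace ℂ H] {T : H →L[ℂ] H} {d : ℕ}
  {E : ℕ → Fin d → H} {ρ : ℕ → ℂ} {g : Fin d → Fin d → ℂ}

theorem IsMonomialFamily.pow_map_eq (hE : IsMonomialFamily T E) (n p : ℕ) (l : Fin d) :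
    (T ^ n) (E p l) = E (p + n) l := by
  induction n with
  | zero => rfl
  | succ n ih => rw [pow_succ', mul_apply_eq_comp, ih, hE.map_eq, add_assoc]

section Adjoint

variable [CompleteSpace H]

theorem IsMonomialFamily.inner_adjoint_pow (hE : IsMonomialFamily T E) (k p : ℕ) (l : Fin d)
    (f : H) : ⟪E p l, (T.adjoint ^ k) f⟫_ℂ = ⟪E (p + k) l, f⟫_ℂ := by
  rw [← hE.pow_map_eq, ← ContinuousLinearMap.star_eq_adjoint, ← star_pow,
    ContinuousLinearMap.star_eq_adjoint, ContinuousLinearMap.adjoint_inner_right]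

theorem IsMonomialFamily.adjoint_pow_eq_zero (hE : IsMonomialFamily T E) {k p : ℕ} {l : Fin d}
    (h : p + l < k) : (T.adjoint ^ k) (E p l) = 0 :=
  hE.eq_zero_of_inner _ fun q r => by
    rw [hE.inner_adjoint_pow, hE.inner_eq_zero (by omega)]

theorem IsMonomialFamily.mem_span_of_adjoint_pow_eq_zero (hE : IsMonomialFamily T E) {k : ℕ}
    {f : H} (hf : (T.adjoint ^ k) f = 0) :
    f ∈ Submodule.span ℂ (Set.range fun x : ℕ × Fin d => E x.1 x.2) := by
  let B : Set (ℕ × Fin d) := {x | x.1 + x.2 < k + d}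
  have hB : B.Finite :=
    ((Set.finite_lt_nat (k + d)).prod Set.finite_univ).subset fun x (hx : x.1 + x.2 < k + d) =>
      ⟨show x.1 < k + d by omega, trivial⟩
  let V : Submodule ℂ H := .span ℂ ((fun x : ℕ × Fin d => E x.1 x.2) '' B)
  have : FiniteDimensional ℂ V := .span_of_finite ℂ (hB.image _)
  have hperp : ∀ p l, ⟪E p l, f - V.starProjection f⟫_ℂ = 0 := fun p l => by
    by_cases hpl : p + l < k + d
    · exact V.inner_right_of_mem_orthogonal (Submodule.subset_span ⟨(p, l), hpl, rfl⟩)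
        (V.sub_starProjection_mem_orthogonal f)
    · have hpV : (ℂ ∙ E p l) ⟂ V := Submodule.isOrtho_span.2 <| by
        rintro _ rfl _ ⟨x, hx : x.1 + x.2 < k + d, rfl⟩
        exact hE.inner_eq_zero (by omega)
      have hpk : p = p - k + k := by omega
      rw [inner_sub_right, hpV.inner_eq (Submodule.mem_span_singleton_self _)
        (V.starProjection_apply_mem f), hpk, ← hE.inner_adjoint_pow, hf, inner_zero_right, sub_zero]
  rw [sub_eq_zero.1 (hE.eq_zero_of_inner _ hperp)]
  exact Submodule.span_mono (Set.image_subset_range _ _) (V.starProjection_apply_mem f)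

theorem IsMonomialFamily.exists_mem_span_of_isReducing (hE : IsMonomialFamily T E)
    {N : Submodule ℂ H} (hN : IsReducing T N) (hN0 : N ≠ ⊥) :
    ∃ f ∈ N, f ∈ Submodule.span ℂ (Set.range fun x : ℕ × Fin d => E x.1 x.2) ∧ f ≠ 0 := by
  have : CompleteSpace N := hN.1.completeSpace_coe
  obtain ⟨p, l, hpl⟩ : ∃ p l, N.starProjection (E p l) ≠ 0 := by
    by_contra! h
    refine hN0 ((Submodule.eq_bot_iff N).2 fun f hf => hE.eq_zero_of_inner f fun p l => ?_)
    rw [← N.starProjection_eq_self_iff.2 hf, ← N.inner_starProjection_left_eq_right, h,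
      inner_zero_left]
  refine ⟨_, N.starProjection_apply_mem (E p l),
    hE.mem_span_of_adjoint_pow_eq_zero (k := p + l + 1) ?_, hpl⟩
  rw [← mul_apply_eq_comp, (hN.commute_adjoint_starProjection.pow_left _).eq,
    mul_apply_eq_comp, hE.adjoint_pow_eq_zero (Nat.lt_succ_self _), map_zero]

end Adjoint

theorem HasGramLimit.tendsto_of_le (hg : HasGramLimit E ρ g) {p q : ℕ} {l r a b : Fin d}
    (h : p + l = q + r) (hal : a ≤ l) (hbr : b ≤ r) :
    Tendsto (fun n : ℕ => ρ n * (n : ℂ) ^ (a + b : ℕ) * ⟪E (p + n) l, E (q + n) r⟫_ℂ) atTop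
      (𝓝 (if l = a ∧ r = b then g a b else 0)) := by
  split_ifs with hab
  · obtain ⟨rfl, rfl⟩ := hab
    exact hg h
  have hexp : (l + r - (a + b) : ℕ) ≠ 0 := fun h0 => hab ⟨Fin.ext (by omega), Fin.ext (by omega)⟩
  have hdecay : Tendsto (fun n : ℕ => ((n : ℂ)⁻¹) ^ (l + r - (a + b) : ℕ)) atTop (𝓝 0) := by
    simpa [hexp] using (tendsto_inv_atTop_nhds_zero_nat (𝕜 := ℂ)).pow (l + r - (a + b) : ℕ)
  rw [← zero_mul (g l r)]
  refine (hdecay.mul (hg h)).congr' ?_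
  filter_upwards [eventually_ne_atTop 0] with n hn
  have hpow : (n : ℂ) ^ (l + r : ℕ) = n ^ (l + r - (a + b) : ℕ) * n ^ (a + b : ℕ) := by
    rw [← pow_add]
    congr 1
    omega
  rw [hpow, inv_pow]
  field_simp

theorem HasGramLimit.tendsto_of_toLex_le (hE : IsMonomialFamily T E) (hg : HasGramLimit E ρ g)
    {x x₀ y y₀ : ℕ × Fin d}
    (hx : toLex (x₀.2, OrderDual.toDual x₀.1) ≤ toLex (x.2, OrderDual.toDual x.1))
    (hy : toLex (y₀.2, y₀.1) ≤ toLex (y.2, y.1)) :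
    Tendsto (fun n : ℕ => ρ n * (n : ℂ) ^ (x₀.2 + y₀.2 : ℕ) *
      ⟪E (x.1 + (y₀.1 + y₀.2) + n) x.2, E (y.1 + (x₀.1 + x₀.2) + n) y.2⟫_ℂ) atTop
      (𝓝 (if x = x₀ ∧ y = y₀ then g x₀.2 y₀.2 else 0)) := by
  simp only [Prod.Lex.toLex_le_toLex, OrderDual.toDual_le_toDual] at hx hy
  by_cases hdeg : x.1 + (y₀.1 + y₀.2) + x.2 = y.1 + (x₀.1 + x₀.2) + y.2
  · have hiff : x.2 = x₀.2 ∧ y.2 = y₀.2 ↔ x = x₀ ∧ y = y₀ := by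
      simp only [Prod.ext_iff, Fin.ext_iff, Fin.lt_def] at hx hy ⊢
      omega
    have hlim := hg.tendsto_of_le hdeg (a := x₀.2) (b := y₀.2) (by omega) (by omega)
    simpa only [hiff] using hlim
  · rw [if_neg (by rintro ⟨rfl, rfl⟩; exact hdeg (by ring))]
    refine tendsto_const_nhds.congr fun n => ?_
    rw [hE.inner_eq_zero (by omega), mul_zero]

/-- A pair of vectors in the span of `E` is tested along the shifts that put their leading terms in
the same degree. The leading index `l` is the least one, and ties are broken in opposite directions
in the two factors, so that no other pair of terms with the same `l`, `r` has matching degrees. -/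
theorem IsMonomialFamily.exists_inner_pow_ne_zero (hE : IsMonomialFamily T E)
    (hg : HasGramLimit E ρ g) (hg0 : ∀ l r, g l r ≠ 0) {u v : H}
    (hu : u ∈ Submodule.span ℂ (Set.range fun x : ℕ × Fin d => E x.1 x.2)) (hu0 : u ≠ 0)
    (hv : v ∈ Submodule.span ℂ (Set.range fun x : ℕ × Fin d => E x.1 x.2)) (hv0 : v ≠ 0) :
    ∃ k n : ℕ, ⟪(T ^ k) u, (T ^ n) v⟫_ℂ ≠ 0 := by
  obtain ⟨c, rfl⟩ := Finsupp.mem_span_range_iff_exists_finsupp.1 hu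
  obtain ⟨e, rfl⟩ := Finsupp.mem_span_range_iff_exists_finsupp.1 hv
  obtain ⟨x₀, hx₀, hxmin⟩ := c.support.exists_min_image
    (fun x => toLex (x.2, OrderDual.toDual x.1))
    (Finsupp.support_nonempty_iff.2 fun hc => hu0 (by simp [hc]))
  obtain ⟨y₀, hy₀, hymin⟩ := e.support.exists_min_image (fun y => toLex (y.2, y.1))
    (Finsupp.support_nonempty_iff.2 fun he => hv0 (by simp [he]))
  by_contra! hzero
  have hterms := tendsto_finsetSum c.support fun x hx => tendsto_finsetSum e.support fun y hy =>
    (hg.tendsto_of_toLex_le hE (hxmin x hx) (hymin y hy)).const_mul (conj (c x) * e y)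
  have hsum : ∀ n : ℕ, ∑ x ∈ c.support, ∑ y ∈ e.support, conj (c x) * e y *
      (ρ n * (n : ℂ) ^ (x₀.2 + y₀.2 : ℕ) *
        ⟪E (x.1 + (y₀.1 + y₀.2) + n) x.2, E (y.1 + (x₀.1 + x₀.2) + n) y.2⟫_ℂ) = 0 := fun n => by
    have h := congrArg (ρ n * (n : ℂ) ^ (x₀.2 + y₀.2 : ℕ) * ·)
      (hzero (y₀.1 + y₀.2 + n) (x₀.1 + x₀.2 + n))
    simp only [Finsupp.sum, map_sum, map_smul, hE.pow_map_eq, sum_inner, inner_sum,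
      inner_smul_left, inner_smul_right, mul_zero, Finset.mul_sum] at h
    rw [← h, Finset.sum_comm]
    exact Finset.sum_congr rfl fun y _ => Finset.sum_congr rfl fun x _ => by
      simp only [add_assoc]
      ring
  have hlim := tendsto_nhds_unique (hterms.congr hsum) tendsto_const_nhds
  rw [Finset.sum_eq_single_of_mem x₀ hx₀ fun x _ hx => Finset.sum_eq_zero fun y _ => by simp [hx],
    Finset.sum_eq_single_of_mem y₀ hy₀ fun y _ hy => by simp [hy]] at hlim
  simp only [and_self, if_true, mul_eq_zero, map_eq_zero, hg0, or_false] at hlim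
  exact hlim.elim (Finsupp.mem_support_iff.1 hx₀) (Finsupp.mem_support_iff.1 hy₀)

theorem IsMonomialFamily.isIrreducibleOp [CompleteSpace H] [NeZero d]
    (hE : IsMonomialFamily T E) (hg : HasGramLimit E ρ g) (hg0 : ∀ l r, g l r ≠ 0) :
    IsIrreducibleOp T := by
  refine ⟨not_subsingleton_iff_nontrivial.1 fun _ => hg0 0 0 ?_, fun N hN => ?_⟩
  · have hlim := hg (p := 0) (q := 0) (l := 0) (r := 0) rfl
    simp only [Subsingleton.elim (E _ _) 0, inner_zero_left, mul_zero] at hlim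
    exact tendsto_nhds_unique hlim tendsto_const_nhds
  · have : CompleteSpace N := hN.1.completeSpace_coe
    by_contra! h
    obtain ⟨u, huN, hu, hu0⟩ := hE.exists_mem_span_of_isReducing hN h.1
    obtain ⟨v, hvN, hv, hv0⟩ := hE.exists_mem_span_of_isReducing hN.orthogonal
      (fun hbot => h.2 (N.orthogonal_eq_bot_iff.1 hbot))
    obtain ⟨k, n, hkn⟩ := hE.exists_inner_pow_ne_zero hg hg0 hu hu0 hv hv0
    exact hkn (N.inner_right_of_mem_orthogonal (hN.pow_mem huN k) (hN.orthogonal.pow_mem hvN n))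

end MonomialFamily

theorem ascPochhammer_eval_add (a b : ℕ) (x : ℝ) :
    (ascPochhammer ℝ (a + b)).eval x =
      (ascPochhammer ℝ a).eval x * (ascPochhammer ℝ b).eval (x + a) := by
  rw [← ascPochhammer_mul, Polynomial.eval_mul, Polynomial.eval_comp]
  simp

theorem ascPochhammer_eval_succ_left (n : ℕ) (x : ℝ) :
    (ascPochhammer ℝ (n + 1)).eval x = x * (ascPochhammer ℝ n).eval (x + 1) := by
  rw [add_comm, ascPochhammer_eval_add]
  simp

/-- The coefficient of the derivative `f^{(l - j)}` in the `l`-th component of `Γ_j f`, as a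
function of `x = 2λ - m`. -/
def gamCoeff (x : ℝ) (l j : ℕ) : ℝ :=
  l.choose j / (ascPochhammer ℝ (l - j)).eval (x + 2 * j)

/-- The entries of the inverse of the lower triangular matrix `gamCoeff x`. -/
def gamInvCoeff (x : ℝ) (i l : ℕ) : ℝ :=
  (-1) ^ (i + l) * i.choose l / (ascPochhammer ℝ (i - l)).eval (x + i + l - 1)

theorem gamCoeff_of_lt (x : ℝ) {l j : ℕ} (h : l < j) : gamCoeff x l j = 0 := by
  simp [gamCoeff, Nat.choose_eq_zero_of_lt h]

theorem gamCoeff_self (x : ℝ) (j : ℕ) : gamCoeff x j j = 1 := by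
  simp [gamCoeff]

theorem gamInvCoeff_of_lt (x : ℝ) {i l : ℕ} (h : i < l) : gamInvCoeff x i l = 0 := by
  simp [gamInvCoeff, Nat.choose_eq_zero_of_lt h]

theorem gamInvCoeff_self (x : ℝ) (i : ℕ) : gamInvCoeff x i i = 1 := by
  simp [gamInvCoeff, (Even.add_self i).neg_one_pow]

theorem neg_one_pow_mul_gamInvCoeff_pos {x : ℝ} (hx : 0 < x) {i l : ℕ} (h : l ≤ i) :
    0 < (-1) ^ (i + l) * gamInvCoeff x i l := by
  have hchoose : (0 : ℝ) < i.choose l := by exact_mod_cast Nat.choose_pos h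
  have hpoch : 0 < (ascPochhammer ℝ (i - l)).eval (x + i + l - 1) := by
    rcases h.eq_or_lt with rfl | hlt
    · simp
    · have hi : (1 : ℝ) ≤ i := by exact_mod_cast (by omega : 1 ≤ i)
      exact ascPochhammer_pos _ _ (by linarith [l.cast_nonneg (α := ℝ)])
  rw [gamInvCoeff, mul_div_assoc, ← mul_assoc, ← pow_add, (Even.add_self _).neg_one_pow, one_mul]
  positivity

section GamMatrix

variable {x : ℝ}

theorem mul_gamCoeff (hx : 0 < x) (l j : ℕ) :
    (l - j) * (x + j + l - 1) * gamCoeff x l j = l * gamCoeff x (l - 1) j := by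
  rcases lt_trichotomy l j with h | rfl | h
  · simp [gamCoeff_of_lt x h, gamCoeff_of_lt x ((Nat.sub_le l 1).trans_lt h)]
  · rcases l with _ | l
    · simp
    · simp [gamCoeff_of_lt x l.lt_succ_self]
  obtain ⟨k, rfl⟩ := Nat.exists_eq_add_of_lt h
  have hchoose : ((j + k).choose j : ℝ) * (j + k + 1) = (j + k + 1).choose j * (k + 1) := by
    have := Nat.choose_mul_succ_eq (j + k) j
    rw [show j + k + 1 - j = k + 1 by omega] at this
    exact_mod_cast this
  have hfactor : x + j + (j + k + 1 : ℕ) - 1 = x + 2 * j + k := by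
    push_cast
    ring
  rw [gamCoeff, gamCoeff, show j + k + 1 - j = k + 1 by omega, Nat.add_sub_cancel,
    Nat.add_sub_cancel_left, ascPochhammer_succ_eval, hfactor]
  generalize (ascPochhammer ℝ k).eval (x + 2 * j) = P
  field_simp
  push_cast
  linear_combination -hchoose / P

theorem mul_gamInvCoeff (hx : 0 < x) (i l : ℕ) :
    (i - l) * (x + i + l - 1) * gamInvCoeff x i l = -(l + 1) * gamInvCoeff x i (l + 1) := by
  rcases lt_trichotomy i l with h | rfl | h
  · simp [gamInvCoeff_of_lt x h, gamInvCoeff_of_lt x (Nat.lt_succ_of_lt h)]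
  · simp [gamInvCoeff_of_lt x i.lt_succ_self]
  obtain ⟨k, rfl⟩ := Nat.exists_eq_add_of_lt h
  have hpos : 0 < x + (l + k + 1 : ℕ) + l - 1 := by
    push_cast
    linarith [(by positivity : 0 < x + l + k + l)]
  have hpoch : (ascPochhammer ℝ k).eval (x + (l + k + 1 : ℕ) + (l + 1 : ℕ) - 1) ≠ 0 :=
    (ascPochhammer_pos _ _ (by push_cast at hpos ⊢; linarith)).ne'
  have hshift : x + (l + k + 1 : ℕ) + l - 1 + 1 = x + (l + k + 1 : ℕ) + (l + 1 : ℕ) - 1 := by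
    push_cast
    ring
  have hchoose : ((l + k + 1).choose (l + 1) : ℝ) * (l + 1) = (l + k + 1).choose l * (k + 1) := by
    have := Nat.choose_succ_right_eq (l + k + 1) l
    rw [show l + k + 1 - l = k + 1 by omega] at this
    exact_mod_cast this
  rw [gamInvCoeff, gamInvCoeff, show l + k + 1 - l = k + 1 by omega,
    show l + k + 1 - (l + 1) = k by omega, ascPochhammer_eval_succ_left, hshift]
  field_simp
  push_cast
  linear_combination -(-1) ^ (l + k + 1 + l) * hchoose

/-- `gamInvCoeff x i ·` and `gamCoeff x · j` are left and right eigenvectors, for the eigenvalues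
`i * (i + x - 1)` and `j * (j + x - 1)`, of one and the same bidiagonal matrix. -/
theorem sum_gamInvCoeff_mul_gamCoeff (hx : 0 < x) {n i : ℕ} (hi : i < n) (j : ℕ) :
    ∑ l ∈ Finset.range n, gamInvCoeff x i l * gamCoeff x l j = if i = j then 1 else 0 := by
  split_ifs with hij
  · subst hij
    rw [Finset.sum_eq_single_of_mem i (Finset.mem_range.2 hi), gamCoeff_self, gamInvCoeff_self,
      mul_one]
    intro l _ hl
    rcases hl.lt_or_gt with h | h
    · rw [gamCoeff_of_lt x h, mul_zero]
    · rw [gamInvCoeff_of_lt x h, zero_mul]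
  · have htele : ∀ n, ((i : ℝ) - j) * (x + i + j - 1) *
        ∑ l ∈ Finset.range n, gamInvCoeff x i l * gamCoeff x l j =
          -(n * gamInvCoeff x i n * gamCoeff x (n - 1) j) := fun n => by
      induction n with
      | zero => simp
      | succ n ih =>
        rw [Finset.sum_range_succ, mul_add, ih, Nat.add_sub_cancel]
        push_cast
        linear_combination gamCoeff x n j * mul_gamInvCoeff hx i n +
          gamInvCoeff x i n * mul_gamCoeff hx n j
    have hβ : ((i : ℝ) - j) * (x + i + j - 1) ≠ 0 := by
      refine mul_ne_zero (sub_ne_zero.2 (by exact_mod_cast hij)) ?_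
      have : (1 : ℝ) ≤ i + j := by exact_mod_cast (by omega : 1 ≤ i + j)
      linarith
    simpa [gamInvCoeff_of_lt x hi, hβ] using htele n

/-- The matrix of `(f_j)_j ↦ ∑_j Γ_j f_j`: its `l, j` entry is the coefficient of `f_j^{(l - j)}` in
the `l`-th component, with `x = 2λ - m`. -/
def gamMatrix (x : ℝ) (n : ℕ) : Matrix (Fin n) (Fin n) ℝ := .of fun l j => gamCoeff x l j

/-- The inverse of `gamMatrix x n`. -/
def gamInvMatrix (x : ℝ) (n : ℕ) : Matrix (Fin n) (Fin n) ℝ := .of fun i l => gamInvCoeff x i l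

theorem gamMatrix_apply_of_lt (x : ℝ) {n : ℕ} {l j : Fin n} (h : l < j) : gamMatrix x n l j = 0 :=
  gamCoeff_of_lt x h

theorem gamInvMatrix_apply_of_lt (x : ℝ) {n : ℕ} {i l : Fin n} (h : i < l) :
    gamInvMatrix x n i l = 0 :=
  gamInvCoeff_of_lt x h

theorem gamInvMatrix_mul_gamMatrix (hx : 0 < x) (n : ℕ) : gamInvMatrix x n * gamMatrix x n = 1 := by
  ext i j
  simp only [gamInvMatrix, gamMatrix, Matrix.mul_apply, Matrix.of_apply, Matrix.one_apply,
    Fin.ext_iff, ← sum_gamInvCoeff_mul_gamCoeff hx i.isLt]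
  exact Fin.sum_univ_eq_sum_range (fun l => gamInvCoeff x i l * gamCoeff x l j) n

theorem gamMatrix_mul_gamInvMatrix (hx : 0 < x) (n : ℕ) : gamMatrix x n * gamInvMatrix x n = 1 :=
  mul_eq_one_comm.1 (gamInvMatrix_mul_gamMatrix hx n)

end GamMatrix

theorem iteratedDeriv_id_mul {𝕜 : Type*} [NontriviallyNormedField 𝕜] {φ : 𝕜 → 𝕜} {z : 𝕜} {n : ℕ}
    (hφ : ContDiffAt 𝕜 n φ z) :
    iteratedDeriv n (fun w => w * φ w) z =
      z * iteratedDeriv n φ z + n * iteratedDeriv (n - 1) φ z := by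
  refine (iteratedDeriv_mul contDiffAt_id hφ).trans ?_
  rcases n with _ | n
  · simp
  rw [Finset.sum_range_succ', Finset.sum_range_succ', Finset.sum_eq_zero fun i _ => ?_]
  · simp [add_comm]
  · simp [iteratedDeriv_fun_id]

theorem iteratedDeriv_iteratedDeriv {𝕜 F : Type*} [NontriviallyNormedField 𝕜]
    [NormedAddCommGroup F] [NormedSpace 𝕜 F] (a b : ℕ) (φ : 𝕜 → F) :
    iteratedDeriv a (iteratedDeriv b φ) = iteratedDeriv (a + b) φ := by
  simp only [iteratedDeriv_eq_iterate, Function.iterate_add_apply]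

theorem weight_succ_sq {lam : ℝ} (h : 0 < lam) (n : ℕ) :
    weight lam (n + 1) ^ 2 = weight lam n ^ 2 * ((2 * lam + n) / (n + 1)) := by
  have : (n.factorial : ℝ) ≠ 0 := by positivity
  rw [weight_sq h, weight_sq h, ascPochhammer_succ_eval, Nat.factorial_succ]
  push_cast
  field_simp

theorem weight_le_weight_of_le {lam lam' : ℝ} (h : 0 < lam) (hle : lam ≤ lam') (n : ℕ) :
    weight lam n ≤ weight lam' n := by
  have h' := h.trans_le hle
  rw [← sq_le_sq₀ (weight_pos h n).le (weight_pos h' n).le]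
  induction n with
  | zero => simp [weight]
  | succ n ih =>
    rw [weight_succ_sq h, weight_succ_sq h']
    gcongr

theorem weight_sq_le_mul_weight_succ_sq {lam : ℝ} (h : 0 < lam) (n : ℕ) :
    weight lam n ^ 2 ≤ (1 + 1 / (2 * lam)) * weight lam (n + 1) ^ 2 := by
  have hratio : 1 ≤ (1 + 1 / (2 * lam)) * ((2 * lam + n) / (n + 1)) := by
    have : (0 : ℝ) ≤ n := n.cast_nonneg
    field_simp
    nlinarith [mul_pos h h, mul_nonneg h.le this]
  rw [weight_succ_sq h, mul_left_comm]
  exact le_mul_of_one_le_right (sq_nonneg _) hratio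

theorem succ_mul_weight_succ_sq_le {lam : ℝ} (h : 0 < lam) (n : ℕ) :
    ((n + 1) * weight lam (n + 1)) ^ 2 ≤
      2 * lam * (2 * lam + 1) * weight (lam + 1) n ^ 2 := by
  have hpoch : (ascPochhammer ℝ (n + 1)).eval (2 * lam) * (2 * lam + n + 1) =
      2 * lam * (2 * lam + 1) * (ascPochhammer ℝ n).eval (2 * (lam + 1)) := by
    have hsucc := ascPochhammer_succ_eval (n + 1) (2 * lam)
    rw [ascPochhammer_eval_succ_left, ascPochhammer_eval_succ_left,
      show 2 * lam + 1 + 1 = 2 * (lam + 1) by ring] at hsucc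
    push_cast at hsucc
    linear_combination -hsucc
  have hpos := ascPochhammer_pos (n + 1) (2 * lam) (by positivity)
  rw [mul_pow, weight_sq h, weight_sq (by positivity), mul_div_assoc', mul_div_assoc', ← hpoch,
    Nat.factorial_succ]
  push_cast
  field_simp
  linarith

namespace Berg

variable {lam : ℝ} {h : 0 < lam}

/-- The function `zⁿ` as an element of `A^{(λ)}(𝔻)`. -/
def monomial (lam : ℝ) (h : 0 < lam) (n : ℕ) : Berg lam h :=
  (weight lam n : ℂ)⁻¹ • (show Berg lam h from lp.single 2 n (1 : ℂ))

theorem weight_ne_zero (h : 0 < lam) (n : ℕ) : (weight lam n : ℂ) ≠ 0 := by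
  exact_mod_cast (weight_pos h n).ne'

theorem coord_monomial (n k : ℕ) :
    coord (monomial lam h n) k = if k = n then (weight lam n : ℂ)⁻¹ else 0 := by
  change (weight lam n : ℂ)⁻¹ * lp.single (E := fun _ : ℕ => ℂ) 2 n (1 : ℂ) k = _
  simp [lp.single_apply, Pi.single_apply]

theorem fn_monomial (n : ℕ) (z : ℂ) : fn (monomial lam h n) z = z ^ n := by
  rw [fn, tsum_eq_single n fun k hk => by simp [coord_monomial, hk]]
  simp [coord_monomial, weight_ne_zero h]

theorem inner_monomial_left (n : ℕ) (f : Berg lam h) :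
    ⟪monomial lam h n, f⟫_ℂ = coord f n / weight lam n := by
  have hsingle := lp.inner_single_left (𝕜 := ℂ) (G := fun _ : ℕ => ℂ) n 1 f
  refine (inner_smul_left _ _ _).trans ((congrArg _ hsingle).trans ?_)
  simp only [coord, map_inv₀, Complex.conj_ofReal, div_eq_inv_mul]
  simp

theorem inner_monomial_monomial (n k : ℕ) :
    ⟪monomial lam h n, monomial lam h k⟫_ℂ =
      if n = k then (n.factorial / (ascPochhammer ℝ n).eval (2 * lam) : ℝ) else 0 := by
  rw [inner_monomial_left, coord_monomial]
  split_ifs with hnk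
  · subst hnk
    rw [div_eq_mul_inv, ← mul_inv, ← sq, ← Complex.ofReal_pow, weight_sq h, ← Complex.ofReal_inv,
      inv_div]
  · exact zero_div _

theorem hasSum_monomial (f : Berg lam h) :
    HasSum (fun n => ((weight lam n : ℂ) * coord f n) • monomial lam h n) f := by
  refine (lp.hasSum_single (p := 2) (E := fun _ : ℕ => ℂ) (by simp) f).congr_fun fun n => ?_
  have hsmul := lp.single_smul (E := fun _ : ℕ => ℂ) 2 n (coord f n) (1 : ℂ)
  rw [smul_eq_mul, mul_one] at hsmul
  rw [monomial, smul_smul, mul_right_comm, mul_inv_cancel₀ (weight_ne_zero h n), one_mul]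
  exact hsmul.symm

theorem eq_zero_of_inner_monomial (f : Berg lam h) (hf : ∀ n, ⟪monomial lam h n, f⟫_ℂ = 0) :
    f = 0 := by
  have hcoord : ∀ n, coord f n = 0 := fun n => by
    simpa [inner_monomial_left, weight_ne_zero h] using hf n
  exact (hasSum_monomial f).unique (by simp [hcoord])

theorem hasSum_deriv_fn (f : Berg lam h) {z : ℂ} (hz : ‖z‖ < 1) :
    HasSum (fun n => (weight lam n * coord f n) * (n * z ^ (n - 1))) (deriv (fn f) z) := by
  have hsum := (hasSum_monomial f).mapL (derivCLM lam h 1 ⟨z, by simpa using hz⟩)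
  have hterm : ∀ n, deriv (fn (monomial lam h n)) z = n * z ^ (n - 1) := fun n => by
    rw [funext (fn_monomial n), deriv_pow_field]
  rw [← iteratedDeriv_one]
  refine hsum.congr_fun fun n => ?_
  rw [map_smul, smul_eq_mul, ← hterm, ← iteratedDeriv_one]
  rfl

theorem exists_coord_eq (h : 0 < lam) {c : ℕ → ℂ} (hc : Summable fun n => ‖c n‖ ^ 2) :
    ∃ g : Berg lam h, ∀ n, coord g n = c n :=
  ⟨(⟨c, (memℓp_gen_iff (p := 2) (by norm_num)).2 (by simpa using hc)⟩ :
    lp (fun _ : ℕ => ℂ) 2), fun _ => rfl⟩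

theorem summable_norm_coord_sq (f : Berg lam h) : Summable fun n => ‖coord f n‖ ^ 2 := by
  have := (memℓp_gen_iff (p := 2) (by norm_num)).1 (lp.memℓp (E := fun _ : ℕ => ℂ) (p := 2) f)
  simpa [coord] using this

theorem exists_coord_eq_mul {lam' : ℝ} (h' : 0 < lam') (f : Berg lam h) (d : ℕ) {c : ℕ → ℝ}
    {C : ℝ} (hc : ∀ n, c n ^ 2 ≤ C) :
    ∃ g : Berg lam' h', ∀ n, coord g n = c n * coord f (n + d) := by
  refine exists_coord_eq h' (.of_nonneg_of_le (fun n => by positivity) (fun n => ?_)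
    (((summable_nat_add_iff d).2 (summable_norm_coord_sq f)).mul_left C))
  rw [norm_mul, mul_pow, Complex.norm_real, Real.norm_eq_abs, sq_abs]
  gcongr
  exact hc n

theorem exists_fn_eqOn_of_le {lam' : ℝ} (f : Berg lam h) (hle : lam ≤ lam') :
    ∃ g : Berg lam' (h.trans_le hle), Set.EqOn (fn g) (fn f) (Metric.ball 0 1) := by
  have h' := h.trans_le hle
  obtain ⟨g, hg⟩ := exists_coord_eq_mul h' f 0 (c := fun n => weight lam n / weight lam' n)
    (C := 1) fun n => by
      have hw := (weight_pos h n).le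
      have hw' := weight_pos h' n
      exact pow_le_one₀ (by positivity) ((div_le_one hw').2 (weight_le_weight_of_le h hle n))
  refine ⟨g, fun z _ => tsum_congr fun n => ?_⟩
  have := weight_ne_zero h' n
  rw [hg, add_zero]
  push_cast
  field_simp

theorem exists_fn_eqOn_id_mul (f : Berg lam h) :
    ∃ g : Berg lam h, Set.EqOn (fn g) (fun z => z * fn f z) (Metric.ball 0 1) := by
  obtain ⟨g, hg⟩ : ∃ g : Berg lam h, ∀ n, coord g n = Nat.casesOn n 0 fun n =>
      ((weight lam n / weight lam (n + 1) : ℝ) : ℂ) * coord f n := by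
    refine exists_coord_eq h ((summable_nat_add_iff 1).1 (.of_nonneg_of_le
      (fun n => by positivity) (fun n => ?_)
      ((summable_norm_coord_sq f).mul_left (1 + 1 / (2 * lam)))))
    have hw := weight_pos h (n + 1)
    simp only [norm_mul, mul_pow, Complex.norm_real, Real.norm_eq_abs, sq_abs, div_pow]
    gcongr
    rw [div_le_iff₀ (by positivity)]
    exact weight_sq_le_mul_weight_succ_sq h n
  refine ⟨g, fun z hz => ?_⟩
  have hsummable := (hasSum_fn g (mem_ball_zero_iff.1 hz)).summable
  simp only [fn]
  rw [hsummable.tsum_eq_zero_add, ← tsum_mul_left, show coord g 0 = 0 from hg 0, mul_zero,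
    zero_mul, zero_add]
  refine tsum_congr fun n => ?_
  have := weight_ne_zero h (n + 1)
  rw [hg]
  push_cast
  field_simp
  ring

theorem exists_fn_eqOn_deriv (f : Berg lam h) (h' : 0 < lam + 1) :
    ∃ g : Berg (lam + 1) h', Set.EqOn (fn g) (deriv (fn f)) (Metric.ball 0 1) := by
  obtain ⟨g, hg⟩ := exists_coord_eq_mul h' f 1
    (c := fun n => (n + 1) * weight lam (n + 1) / weight (lam + 1) n)
    (C := 2 * lam * (2 * lam + 1)) fun n => by
      have hw := weight_pos h' n
      rw [div_pow, div_le_iff₀ (by positivity)]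
      exact succ_mul_weight_succ_sq_le h n
  refine ⟨g, fun z hz => ?_⟩
  have hsum := hasSum_deriv_fn f (mem_ball_zero_iff.1 hz)
  rw [← hsum.tsum_eq, hsum.summable.tsum_eq_zero_add, fn]
  simp only [Nat.cast_zero, zero_mul, mul_zero, zero_add, Nat.add_sub_cancel]
  refine tsum_congr fun n => ?_
  have := weight_ne_zero h' n
  rw [hg]
  push_cast
  field_simp

theorem exists_fn_eqOn_iteratedDeriv {lam' : ℝ} (h' : 0 < lam') (f : Berg lam h) (d : ℕ)
    (hle : lam + d ≤ lam') :
    ∃ g : Berg lam' h', Set.EqOn (fn g) (iteratedDeriv d (fn f)) (Metric.ball 0 1) := by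
  induction d generalizing lam with
  | zero => simpa using exists_fn_eqOn_of_le f (by simpa using hle)
  | succ d ih =>
    obtain ⟨f', hf'⟩ := exists_fn_eqOn_deriv f (by positivity)
    obtain ⟨g, hg⟩ := ih f' (by push_cast at hle; linarith)
    rw [iteratedDeriv_succ']
    exact ⟨g, hg.trans (hf'.iteratedDeriv_of_isOpen Metric.isOpen_ball d)⟩

end Berg

/-- The operator on `n`-tuples of functions with entries `a l j D^{l - j - s}`. Only entries with
`j + s ≤ l` are meaningful, the subtraction being truncated: `a` is meant to vanish elsewhere. -/
def triDeriv {n : ℕ} (s : ℕ) (a : Matrix (Fin n) (Fin n) ℝ) (φ : Fin n → ℂ → ℂ) (l : Fin n)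
    (z : ℂ) : ℂ :=
  ∑ j, (a l j : ℂ) * iteratedDeriv (l - j - s : ℕ) (φ j) z

section TriDeriv

variable {n : ℕ} {s : ℕ} {a b : Matrix (Fin n) (Fin n) ℝ} {φ : Fin n → ℂ → ℂ} {z : ℂ}

theorem triDeriv_one (φ : Fin n → ℂ → ℂ) : triDeriv 0 1 φ = φ := by
  ext l z
  rw [triDeriv, Finset.sum_eq_single l fun j _ hj => by simp [Matrix.one_apply_ne hj.symm]]
  all_goals simp

theorem triDeriv_eqOn {ψ : Fin n → ℂ → ℂ} {U : Set ℂ} (hU : IsOpen U)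
    (h : ∀ j, Set.EqOn (φ j) (ψ j) U) (l : Fin n) :
    Set.EqOn (triDeriv s a φ l) (triDeriv s a ψ l) U := fun z hz =>
  Finset.sum_congr rfl fun j _ => by rw [(h j).iteratedDeriv_of_isOpen hU _ hz]

theorem analyticAt_triDeriv (hφ : ∀ j, AnalyticAt ℂ (φ j) z) (l : Fin n) :
    AnalyticAt ℂ (triDeriv s a φ l) z :=
  Finset.univ.analyticAt_fun_sum fun j _ => analyticAt_const.mul <| by
    rw [iteratedDeriv_eq_iterate]
    exact (hφ j).iterated_deriv _

theorem mul_apply_eq_zero_of_lt (ha : ∀ l j : Fin n, (l : ℕ) < j + s → a l j = 0)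
    (hb : ∀ l j : Fin n, l < j → b l j = 0) {l k : Fin n} (h : (l : ℕ) < k + s) :
    (a * b) l k = 0 := by
  rw [Matrix.mul_apply]
  refine Finset.sum_eq_zero fun j _ => ?_
  rcases lt_or_ge (l : ℕ) (j + s) with hlj | hlj
  · rw [ha l j hlj, zero_mul]
  · rw [hb j k (by omega), mul_zero]

theorem triDeriv_triDeriv (ha : ∀ l j : Fin n, (l : ℕ) < j + s → a l j = 0)
    (hb : ∀ l j : Fin n, l < j → b l j = 0) (hφ : ∀ j, AnalyticAt ℂ (φ j) z) (l : Fin n) :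
    triDeriv s a (triDeriv 0 b φ) l z = triDeriv s (a * b) φ l z := by
  have hexpand : ∀ j : Fin n, iteratedDeriv (l - j - s : ℕ) (triDeriv 0 b φ j) z =
      ∑ k, (b j k : ℂ) * iteratedDeriv (l - j - s + (j - k) : ℕ) (φ k) z := fun j => by
    have hcd : ∀ k, ContDiffAt ℂ (l - j - s : ℕ)
        (fun w => (b j k : ℂ) * iteratedDeriv (j - k : ℕ) (φ k) w) z := fun k => by
      rw [iteratedDeriv_eq_iterate]
      exact (analyticAt_const.mul ((hφ k).iterated_deriv _)).contDiffAt
    refine (iteratedDeriv_fun_sum fun k _ => hcd k).trans ?_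
    simp only [iteratedDeriv_const_mul_field, iteratedDeriv_iteratedDeriv]
  simp only [triDeriv.eq_def s, hexpand, Matrix.mul_apply, Complex.ofReal_sum, Complex.ofReal_mul,
    Finset.sum_mul, Finset.mul_sum]
  rw [Finset.sum_comm]
  refine Finset.sum_congr rfl fun k _ => Finset.sum_congr rfl fun j _ => ?_
  rcases lt_or_ge (l : ℕ) (j + s) with hlj | hlj
  · simp [ha l j hlj]
  rcases lt_or_ge j k with hjk | hjk
  · simp [hb j k hjk]
  rw [mul_assoc, show (l - j - s + (j - k) : ℕ) = l - k - s by omega]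

theorem triDeriv_id_mul (hφ : ∀ j, AnalyticAt ℂ (φ j) z) (l : Fin n) :
    triDeriv 0 a (fun j w => w * φ j w) l z =
      z * triDeriv 0 a φ l z + triDeriv 1 (.of fun l j => (l - j : ℕ) * a l j) φ l z := by
  simp only [triDeriv, iteratedDeriv_id_mul (hφ _).contDiffAt, Finset.mul_sum,
    ← Finset.sum_add_distrib, Matrix.of_apply]
  refine Finset.sum_congr rfl fun j _ => ?_
  push_cast
  rw [Nat.sub_zero]
  ring

end TriDeriv

theorem two_mul_lamj (m : ℕ) (lam : ℝ) (j : Fin (m + 1)) :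
    2 * lamj m lam j = 2 * lam - m + 2 * (j : ℕ) := by
  rw [lamj]
  ring

theorem Berg.analyticAt_fn {lam : ℝ} {h : 0 < lam} (f : Berg lam h) {z : ℂ}
    (hz : z ∈ Metric.ball 0 1) : AnalyticAt ℂ f.fn z :=
  f.differentiableOn_fn.analyticAt (Metric.isOpen_ball.mem_nhds hz)

namespace ASpace

variable {m : ℕ} {lam : ℝ} {mu : Fin (m + 1) → ℝ} {hlam : (m : ℝ) / 2 < lam}
  {hmu : ∀ j, 0 < mu j}

theorem inner_eq_sum (f g : ASpace m lam mu hlam hmu) :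
    ⟪f, g⟫_ℂ = ∑ j, ⟪comp j f, comp j g⟫_ℂ :=
  PiLp.inner_apply (𝕜 := ℂ) (f := fun j : Fin (m + 1) => Berg (lamj m lam j) (lamj_pos hlam j)) f g

/-- The function `∑_j Γ_j g_j`, without the weights `μ_j`. -/
def sumGam (hlam : (m : ℝ) / 2 < lam) (hmu : ∀ j, 0 < mu j)
    (G : ∀ j : Fin (m + 1), Berg (lamj m lam j) (lamj_pos hlam j)) : ASpace m lam mu hlam hmu :=
  WithLp.toLp 2 fun j => (mu j : ℂ)⁻¹ • G j

theorem comp_sumGam (G : ∀ j : Fin (m + 1), Berg (lamj m lam j) (lamj_pos hlam j))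
    (j : Fin (m + 1)) : comp j (sumGam hlam hmu G) = (mu j : ℂ)⁻¹ • G j := rfl

theorem mu_ne_zero (hmu : ∀ j, 0 < mu j) (j : Fin (m + 1)) : (mu j : ℂ) ≠ 0 := by
  exact_mod_cast (hmu j).ne'

theorem exists_eq_sumGam (f : ASpace m lam mu hlam hmu) :
    ∃ G : ∀ j : Fin (m + 1), Berg (lamj m lam j) (lamj_pos hlam j), f = sumGam hlam hmu G := by
  refine ⟨fun j => (mu j : ℂ) • comp j f, PiLp.ext fun j => ?_⟩
  exact (inv_smul_smul₀ (mu_ne_zero hmu j) _).symm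

theorem sumGam_apply (G : ∀ j : Fin (m + 1), Berg (lamj m lam j) (lamj_pos hlam j)) (z : 𝔻)
    (l : Fin (m + 1)) :
    sumGam hlam hmu G z l =
      triDeriv 0 (gamMatrix (2 * lam - m) (m + 1)) (fun j => Berg.fn (G j)) l z := by
  simp only [coe_apply, comp_sumGam, map_smul, smul_inv_smul₀ (mu_ne_zero hmu _),
    WithLp.ofLp_sum, Finset.sum_apply, triDeriv, gamMatrix, Matrix.of_apply, Gam_apply]
  refine Finset.sum_congr rfl fun j _ => ?_
  split_ifs with hjl
  · rw [two_mul_lamj, gamCoeff, Nat.sub_zero]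
    push_cast
    rfl
  · rw [gamCoeff_of_lt _ (not_le.1 hjl)]
    simp

theorem sumGam_apply_eq_of_eqOn {F : Fin (m + 1) → ℂ → ℂ}
    (hF : ∀ l, DifferentiableOn ℂ (F l) (Metric.ball 0 1))
    {G : ∀ j : Fin (m + 1), Berg (lamj m lam j) (lamj_pos hlam j)}
    (hG : ∀ i, Set.EqOn (G i).fn (triDeriv 0 (gamInvMatrix (2 * lam - m) (m + 1)) F i)
      (Metric.ball 0 1)) (z : 𝔻) (l : Fin (m + 1)) :
    sumGam hlam hmu G z l = F l z := by
  have hz : (z : ℂ) ∈ Metric.ball (0 : ℂ) 1 := by simpa using z.norm_lt_one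
  rw [sumGam_apply, triDeriv_eqOn Metric.isOpen_ball hG l hz,
    triDeriv_triDeriv (fun _ _ h => gamMatrix_apply_of_lt _ h)
      (fun _ _ h => gamInvMatrix_apply_of_lt _ h)
      (fun j => (hF j).analyticAt (Metric.isOpen_ball.mem_nhds hz)),
    gamMatrix_mul_gamInvMatrix (by linarith), triDeriv_one]

theorem exists_fn_eqOn_id_mul_add_triDeriv
    (G : ∀ j : Fin (m + 1), Berg (lamj m lam j) (lamj_pos hlam j))
    {c : Matrix (Fin (m + 1)) (Fin (m + 1)) ℝ} (hc : ∀ i j, i ≤ j → c i j = 0)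
    (i : Fin (m + 1)) :
    ∃ g : Berg (lamj m lam i) (lamj_pos hlam i), Set.EqOn g.fn
      (fun z => z * (G i).fn z + triDeriv 1 c (fun j => (G j).fn) i z) (Metric.ball 0 1) := by
  have hterm : ∀ j, ∃ g : Berg (lamj m lam i) (lamj_pos hlam i), Set.EqOn g.fn
      (fun z => (c i j : ℂ) * iteratedDeriv (i - j - 1 : ℕ) (G j).fn z) (Metric.ball 0 1) := by
    intro j
    rcases le_or_gt i j with hij | hij
    · refine ⟨0, fun z hz => ?_⟩
      simp [hc i j hij, Berg.fn_eq_inner _ (mem_ball_zero_iff.1 hz)]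
    · obtain ⟨g, hg⟩ := Berg.exists_fn_eqOn_iteratedDeriv (lamj_pos hlam i) (G j) (i - j - 1) (by
        have hcast : ((i - j - 1 : ℕ) : ℝ) + j + 1 = i := by
          exact_mod_cast (by omega : (i - j - 1 + j + 1 : ℕ) = i)
        rw [lamj, lamj]
        linarith)
      refine ⟨(c i j : ℂ) • g, fun z hz => ?_⟩
      simp only [Berg.fn_smul _ _ (mem_ball_zero_iff.1 hz), hg hz]
  choose g hg using hterm
  obtain ⟨g₀, hg₀⟩ := Berg.exists_fn_eqOn_id_mul (G i)
  refine ⟨g₀ + ∑ j, g j, fun z hz => ?_⟩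
  have hz' := mem_ball_zero_iff.1 hz
  rw [Berg.fn_eq_inner _ hz', inner_add_right, inner_sum]
  simp only [← Berg.fn_eq_inner _ hz', hg _ hz, hg₀ hz, triDeriv]

theorem exists_apply_eq_smul (f : ASpace m lam mu hlam hmu) :
    ∃ g : ASpace m lam mu hlam hmu, ∀ z : 𝔻, g z = (z : ℂ) • f z := by
  obtain ⟨G, rfl⟩ := exists_eq_sumGam f
  let C := gamMatrix (2 * lam - m) (m + 1)
  let D := gamInvMatrix (2 * lam - m) (m + 1)
  let D' : Matrix (Fin (m + 1)) (Fin (m + 1)) ℝ := .of fun i l => (i - l : ℕ) * D i l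
  have hC : ∀ l j : Fin (m + 1), l < j → C l j = 0 := fun l j h => gamMatrix_apply_of_lt _ h
  have hD : ∀ i l : Fin (m + 1), i < l → D i l = 0 := fun i l h => gamInvMatrix_apply_of_lt _ h
  have hD' : ∀ i l : Fin (m + 1), (i : ℕ) < l + 1 → D' i l = 0 := fun i l h => by
    simp [D', Nat.sub_eq_zero_of_le (Nat.lt_succ_iff.1 h)]
  let F := triDeriv 0 C fun j => (G j).fn
  have hF : ∀ {z : ℂ}, z ∈ Metric.ball 0 1 → ∀ l, AnalyticAt ℂ (F l) z := fun hz =>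
    analyticAt_triDeriv fun j => Berg.analyticAt_fn (G j) hz
  choose g hg using exists_fn_eqOn_id_mul_add_triDeriv (hlam := hlam) G (c := D' * C) fun i j hij =>
    mul_apply_eq_zero_of_lt hD' hC (Nat.lt_succ_of_le hij)
  have hg' : ∀ i, Set.EqOn (g i).fn (triDeriv 0 D (fun l z => z * F l z) i) (Metric.ball 0 1) :=
    fun i z hz => by
      have hDF : triDeriv 0 D F i z = (G i).fn z := by
        rw [triDeriv_triDeriv hD hC (fun j => Berg.analyticAt_fn (G j) hz),
          gamInvMatrix_mul_gamMatrix (by linarith), triDeriv_one]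
      rw [triDeriv_id_mul (hF hz), hDF,
        triDeriv_triDeriv hD' hC (fun j => Berg.analyticAt_fn (G j) hz)]
      exact hg i hz
  refine ⟨sumGam hlam hmu g, fun z => PiLp.ext fun l => ?_⟩
  rw [sumGam_apply_eq_of_eqOn (fun l z hz =>
      (differentiableAt_id.fun_mul (hF hz l).differentiableAt).differentiableWithinAt) hg',
    PiLp.smul_apply, sumGam_apply, smul_eq_mul]

end ASpace

theorem tendsto_eval_natCast_add_div_pow {P : Polynomial ℝ} (hP : P.Monic) (a : ℝ) :
    Tendsto (fun n : ℕ => P.eval (n + a) / (n : ℝ) ^ P.natDegree) atTop (𝓝 1) := by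
  have hdeg : (P.comp (.X + .C a)).degree = (Polynomial.X ^ P.natDegree : Polynomial ℝ).degree := by
    rw [Polynomial.degree_X_pow, Polynomial.degree_eq_natDegree (hP.comp_X_add_C a).ne_zero,
      Polynomial.natDegree_comp, Polynomial.natDegree_X_add_C, mul_one]
  have hlim := Polynomial.div_tendsto_atTop_leadingCoeff_div_of_degree_eq _ _ hdeg
  rw [(hP.comp_X_add_C a).leadingCoeff, (Polynomial.monic_X_pow _).leadingCoeff, div_one] at hlim
  simpa [Function.comp_def] using hlim.comp tendsto_natCast_atTop_atTop

theorem tendsto_ascPochhammer_eval_natCast_add_div_pow (k : ℕ) (a : ℝ) :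
    Tendsto (fun n : ℕ => (ascPochhammer ℝ k).eval (n + a) / (n : ℝ) ^ k) atTop (𝓝 1) := by
  simpa only [ascPochhammer_natDegree] using
    tendsto_eval_natCast_add_div_pow (monic_ascPochhammer ℝ k) a

theorem tendsto_descFactorial_div_pow (k s : ℕ) :
    Tendsto (fun n : ℕ => ((s + n).descFactorial k : ℝ) / (n : ℝ) ^ k) atTop (𝓝 1) := by
  have hlim := tendsto_eval_natCast_add_div_pow (monic_descPochhammer ℝ k) s
  simp only [descPochhammer_natDegree, ← Nat.cast_add, descPochhammer_eval_eq_descFactorial] at hlim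
  simpa only [add_comm s] using hlim

theorem tendsto_ascPochhammer_mul_factorial_div {x : ℝ} (hx : 0 < x) (i s : ℕ) :
    Tendsto (fun n : ℕ => (ascPochhammer ℝ n).eval x / n.factorial * (n : ℝ) ^ (2 * i) *
      ((s + n - i).factorial / (ascPochhammer ℝ (s + n - i)).eval (x + 2 * i))) atTop
      (𝓝 ((ascPochhammer ℝ (2 * i)).eval x)) := by
  have hlim := ((tendsto_ascPochhammer_eval_natCast_add_div_pow s 1).div
    ((tendsto_descFactorial_div_pow i s).mul
      (tendsto_ascPochhammer_eval_natCast_add_div_pow (s + i) x)) (by simp)).const_mul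
    ((ascPochhammer ℝ (2 * i)).eval x)
  rw [mul_one, div_one, mul_one] at hlim
  refine hlim.congr' ?_
  filter_upwards [eventually_ge_atTop (i + 1)] with n hn
  have hfact : ((s + n - i).factorial : ℝ) * (s + n).descFactorial i =
      n.factorial * (ascPochhammer ℝ s).eval (n + 1 : ℝ) := by
    rw [← Nat.cast_succ, ascPochhammer_nat_eq_natCast_ascFactorial]
    exact_mod_cast (Nat.factorial_mul_descFactorial (by omega)).trans
      ((congrArg _ (add_comm s n)).trans (Nat.factorial_mul_ascFactorial n s).symm)
  have hpoch : (ascPochhammer ℝ (2 * i)).eval x *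
      (ascPochhammer ℝ (s + n - i)).eval (x + 2 * i) =
        (ascPochhammer ℝ n).eval x * (ascPochhammer ℝ (s + i)).eval (n + x) := by
    have h := ascPochhammer_eval_add (2 * i) (s + n - i) x
    rw [show 2 * i + (s + n - i) = n + (s + i) by omega, ascPochhammer_eval_add] at h
    push_cast at h
    rw [add_comm (n : ℝ), h]
  have hn0 : (n : ℝ) ≠ 0 := by exact_mod_cast (by omega : n ≠ 0)
  have hdesc : ((s + n).descFactorial i : ℝ) ≠ 0 := by
    exact_mod_cast Nat.descFactorial_eq_zero_iff_lt.not.2 (by omega)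
  have hQ := (ascPochhammer_pos (s + n - i) (x + 2 * i) (by positivity)).ne'
  have hR := (ascPochhammer_pos (s + i) (n + x) (by positivity)).ne'
  have hfact0 : (n.factorial : ℝ) ≠ 0 := by exact_mod_cast n.factorial_ne_zero
  simp only [Pi.div_apply, mul_comm 2 i, pow_add, pow_mul] at hpoch ⊢
  generalize x + 2 * (i : ℝ) = y at *
  field_simp
  linear_combination ((s + n).descFactorial i * (s + n - i).factorial : ℝ) * hpoch -
    (ascPochhammer ℝ (i * 2)).eval x * (ascPochhammer ℝ (s + n - i)).eval y * hfact

/-- The inner product of the derivatives `D^a zᵖ` and `D^b z^q` in `A^{(ν)}(𝔻)`, `y = 2ν`. -/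
def derivMonomialInner (y : ℝ) (a b p q : ℕ) : ℝ :=
  p.descFactorial a * q.descFactorial b *
    if p - a = q - b then (p - a).factorial / (ascPochhammer ℝ (p - a)).eval y else 0

theorem derivMonomialInner_eq_zero (y : ℝ) {a b p q : ℕ} (h : p + b ≠ q + a) :
    derivMonomialInner y a b p q = 0 := by
  rcases lt_or_ge p a with hp | hp
  · simp [derivMonomialInner, Nat.descFactorial_of_lt hp]
  rcases lt_or_ge q b with hq | hq
  · simp [derivMonomialInner, Nat.descFactorial_of_lt hq]
  rw [derivMonomialInner, if_neg (by omega), mul_zero]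

theorem tendsto_derivMonomialInner {x : ℝ} (hx : 0 < x) {i l r p q : ℕ} (hli : l ≤ i)
    (hri : r ≤ i) (h : p + l = q + r) :
    Tendsto (fun n : ℕ => (ascPochhammer ℝ n).eval x / n.factorial * (n : ℝ) ^ (l + r) *
      derivMonomialInner (x + 2 * i) (i - l) (i - r) (p + n) (q + n)) atTop
      (𝓝 ((ascPochhammer ℝ (2 * i)).eval x)) := by
  have hlim := ((tendsto_descFactorial_div_pow (i - l) p).mul
    (tendsto_descFactorial_div_pow (i - r) q)).mul
      (tendsto_ascPochhammer_mul_factorial_div hx i (p + l))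
  rw [one_mul, one_mul] at hlim
  refine hlim.congr' ?_
  filter_upwards [eventually_gt_atTop i] with n hn
  have hn0 : (n : ℝ) ≠ 0 := by exact_mod_cast (by omega : n ≠ 0)
  have hpow : (n : ℝ) ^ (2 * i) = n ^ (l + r) * n ^ (i - l) * n ^ (i - r) := by
    rw [← pow_add, ← pow_add]
    congr 1
    omega
  rw [derivMonomialInner, if_pos (by omega), show p + n - (i - l) = p + l + n - i by omega, hpow]
  generalize x + 2 * (i : ℝ) = y
  field_simp

/-- The inner product of `zᵖ e_l` and `z^q e_r` in `A^{(λ,μ)}(𝔻)`, `x = 2λ - m`. -/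
def gram {d : ℕ} (x : ℝ) (mu : Fin d → ℝ) (p q : ℕ) (l r : Fin d) : ℝ :=
  ∑ i : Fin d, gamInvCoeff x i l * gamInvCoeff x i r / mu i ^ 2 *
    derivMonomialInner (x + 2 * (i : ℕ)) (i - l) (i - r) p q

/-- The limit of the rescaled inner products of `z^{p + n} e_l` and `z^{q + n} e_r`,
`p + l = q + r`, as `n → ∞`. -/
def gramLimit {d : ℕ} (x : ℝ) (mu : Fin d → ℝ) (l r : Fin d) : ℝ :=
  ∑ i : Fin d, gamInvCoeff x i l * gamInvCoeff x i r / mu i ^ 2 *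
    (ascPochhammer ℝ (2 * i)).eval x

theorem gram_eq_zero {d : ℕ} (x : ℝ) (mu : Fin d → ℝ) {p q : ℕ} {l r : Fin d}
    (h : p + l ≠ q + r) : gram x mu p q l r = 0 :=
  Finset.sum_eq_zero fun i _ => by
    rcases lt_or_ge i l with hil | hli
    · simp [gamInvCoeff_of_lt x hil]
    rcases lt_or_ge i r with hir | hri
    · simp [gamInvCoeff_of_lt x hir]
    rw [derivMonomialInner_eq_zero _ (by omega), mul_zero]

theorem tendsto_gram {d : ℕ} {x : ℝ} (hx : 0 < x) (mu : Fin d → ℝ) {p q : ℕ} {l r : Fin d}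
    (h : p + l = q + r) :
    Tendsto (fun n : ℕ => (ascPochhammer ℝ n).eval x / n.factorial * (n : ℝ) ^ (l + r : ℕ) *
      gram x mu (p + n) (q + n) l r) atTop (𝓝 (gramLimit x mu l r)) := by
  simp only [gram, Finset.mul_sum, mul_left_comm _ (_ / _)]
  refine tendsto_finsetSum _ fun i _ => ?_
  rcases lt_or_ge i l with hil | hli
  · simp [gamInvCoeff_of_lt x hil]
  rcases lt_or_ge i r with hir | hri
  · simp [gamInvCoeff_of_lt x hir]
  exact (tendsto_derivMonomialInner hx hli hri h).const_mul _

/-- The signs `(-1)^{i + l}` of `gamInvCoeff x i l` and `(-1)^{i + r}` of `gamInvCoeff x i r`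
multiply to one that does not depend on `i`. -/
theorem gramLimit_ne_zero {d : ℕ} {x : ℝ} (hx : 0 < x) {mu : Fin d → ℝ} (hmu : ∀ j, 0 < mu j)
    (l r : Fin d) : gramLimit x mu l r ≠ 0 := by
  have hterm : ∀ i : Fin d, l ≤ i → r ≤ i → 0 < (-1) ^ (l + r : ℕ) *
      (gamInvCoeff x i l * gamInvCoeff x i r / mu i ^ 2 * (ascPochhammer ℝ (2 * i)).eval x) := by
    intro i hli hri
    have hmui := hmu i
    have hpoch := ascPochhammer_pos (2 * i) x hx
    have hl := neg_one_pow_mul_gamInvCoeff_pos hx hli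
    have hr := neg_one_pow_mul_gamInvCoeff_pos hx hri
    have hsign : (-1 : ℝ) ^ (l + r : ℕ) = (-1) ^ (i + l : ℕ) * (-1) ^ (i + r : ℕ) := by
      rw [← pow_add, show (i + l + (i + r) : ℕ) = i + i + (l + r) by ring, pow_add (-1) (i + i : ℕ),
        (Even.add_self _).neg_one_pow, one_mul]
    calc 0 < (-1) ^ (i + l : ℕ) * gamInvCoeff x i l * ((-1) ^ (i + r : ℕ) * gamInvCoeff x i r) /
          mu i ^ 2 * (ascPochhammer ℝ (2 * i)).eval x := by positivity
      _ = _ := by rw [hsign]; ring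
  refine right_ne_zero_of_mul (a := (-1) ^ (l + r : ℕ)) (ne_of_gt ?_)
  rw [gramLimit, Finset.mul_sum]
  refine Finset.sum_pos' (fun i _ => ?_) ⟨max l r, Finset.mem_univ _, hterm _ (le_max_left _ _)
    (le_max_right _ _)⟩
  rcases lt_or_ge i l with hil | hli
  · simp [gamInvCoeff_of_lt x hil]
  rcases lt_or_ge i r with hir | hri
  · simp [gamInvCoeff_of_lt x hir]
  exact (hterm i hli hri).le

namespace ASpace

variable {m : ℕ} {lam : ℝ} {mu : Fin (m + 1) → ℝ} {hlam : (m : ℝ) / 2 < lam}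
  {hmu : ∀ j, 0 < mu j}

/-- The function `zᵖ e_l` as an element of `A^{(λ,μ)}(𝔻)`. -/
def monomial (hlam : (m : ℝ) / 2 < lam) (hmu : ∀ j, 0 < mu j) (p : ℕ) (l : Fin (m + 1)) :
    ASpace m lam mu hlam hmu :=
  sumGam hlam hmu fun i => ((gamInvCoeff (2 * lam - m) i l * p.descFactorial (i - l) : ℝ) : ℂ) •
    Berg.monomial (lamj m lam i) (lamj_pos hlam i) (p - (i - l))

theorem monomial_apply (p : ℕ) (l : Fin (m + 1)) (z : 𝔻) (k : Fin (m + 1)) :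
    monomial hlam hmu p l z k = if k = l then (z : ℂ) ^ p else 0 := by
  refine sumGam_apply_eq_of_eqOn (F := fun k z => if k = l then z ^ p else 0)
    (fun k => ?_) (fun i z hz => ?_) z k
  · split_ifs <;> fun_prop
  · rw [Berg.fn_smul _ _ (mem_ball_zero_iff.1 hz), Berg.fn_monomial, triDeriv,
      Finset.sum_eq_single_of_mem l (Finset.mem_univ _) fun j _ hj => by simp [hj]]
    simp [gamInvMatrix, iteratedDeriv_pow, mul_assoc]

theorem inner_monomial_left (p : ℕ) (l : Fin (m + 1)) (f : ASpace m lam mu hlam hmu) :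
    ⟪monomial hlam hmu p l, f⟫_ℂ =
      ∑ i : Fin (m + 1),
        ((gamInvCoeff (2 * lam - m) i l * p.descFactorial (i - l) / mu i : ℝ) : ℂ) *
          ⟪Berg.monomial (lamj m lam i) (lamj_pos hlam i) (p - (i - l)), comp i f⟫_ℂ := by
  rw [inner_eq_sum]
  refine Finset.sum_congr rfl fun i _ => ?_
  rw [monomial, comp_sumGam, smul_smul, inner_smul_left]
  simp only [map_mul, map_inv₀, Complex.conj_ofReal]
  push_cast
  ring

theorem inner_monomial_monomial (p q : ℕ) (l r : Fin (m + 1)) :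
    ⟪monomial hlam hmu p l, monomial hlam hmu q r⟫_ℂ = (gram (2 * lam - m) mu p q l r : ℂ) := by
  rw [inner_monomial_left, gram, Complex.ofReal_sum]
  refine Finset.sum_congr rfl fun i _ => ?_
  rw [monomial, comp_sumGam, smul_smul, inner_smul_right, Berg.inner_monomial_monomial,
    two_mul_lamj, derivMonomialInner]
  split_ifs
  all_goals
    push_cast
    ring

theorem eq_zero_of_inner_monomial (f : ASpace m lam mu hlam hmu)
    (hf : ∀ p l, ⟪monomial hlam hmu p l, f⟫_ℂ = 0) : f = 0 := by
  refine PiLp.ext fun i => show comp i f = 0 from ?_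
  induction i using WellFoundedGT.induction with
  | _ i ih =>
    refine Berg.eq_zero_of_inner_monomial _ fun p => ?_
    have h := hf p i
    rw [inner_monomial_left, Finset.sum_eq_single_of_mem i (Finset.mem_univ i) fun j _ hj => ?_]
      at h
    · simpa [gamInvCoeff_self, mu_ne_zero hmu] using h
    · rcases hj.lt_or_gt with hji | hij
      · simp [gamInvCoeff_of_lt _ hji]
      · rw [ih j hij, inner_zero_right, mul_zero]

theorem isMonomialFamily {M : ASpace m lam mu hlam hmu →L[ℂ] ASpace m lam mu hlam hmu}
    (hM : ∀ (f : ASpace m lam mu hlam hmu) (z : 𝔻), M f z = (z : ℂ) • f z) :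
    IsMonomialFamily M (monomial hlam hmu) where
  map_eq p l := RKHS.ext fun z => PiLp.ext fun k => by
    rw [hM, PiLp.smul_apply, monomial_apply, monomial_apply, smul_eq_mul, mul_ite, mul_zero,
      pow_succ']
  inner_eq_zero h := by rw [inner_monomial_monomial, gram_eq_zero _ _ h, Complex.ofReal_zero]
  eq_zero_of_inner := eq_zero_of_inner_monomial

theorem hasGramLimit : HasGramLimit (monomial hlam hmu)
    (fun n => ((ascPochhammer ℝ n).eval (2 * lam - m) / n.factorial : ℝ))
    (fun l r => gramLimit (2 * lam - m) mu l r) := fun p q l r h => by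
  have hlim := tendsto_gram (by linarith : 0 < 2 * lam - m) mu h
  refine ((Complex.continuous_ofReal.tendsto _).comp hlim).congr fun n => ?_
  rw [inner_monomial_monomial, Function.comp_apply]
  push_cast
  rfl

end ASpace

end KoranyiMisra

end

theorem mainTheorem1 (m : ℕ) (lam : ℝ) (hlam : (m : ℝ) / 2 < lam)
    (mu : Fin (m + 1) → ℝ) (hmu : ∀ j, 0 < mu j) (hmu0 : mu 0 = 1) :
    ∃ M : KoranyiMisra.ASpace m lam mu hlam hmu →L[ℂ] KoranyiMisra.ASpace m lam mu hlam hmu,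
      (∀ (f : KoranyiMisra.ASpace m lam mu hlam hmu) (z : Complex.UnitDisc),
        M f z = (z : ℂ) • f z) ∧
      KoranyiMisra.IsIrreducibleOp M := by
  obtain ⟨M, hM⟩ := KoranyiMisra.exists_multiplicationCLM (fun z : Complex.UnitDisc => (z : ℂ))
    (KoranyiMisra.ASpace.exists_apply_eq_smul (hlam := hlam) (hmu := hmu))
  have hx : 0 < 2 * lam - m := by linarith
  exact ⟨M, hM, (KoranyiMisra.ASpace.isMonomialFamily hM).isIrreducibleOp
    KoranyiMisra.ASpace.hasGramLimit fun l r =>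
      Complex.ofReal_ne_zero.2 (KoranyiMisra.gramLimit_ne_zero hx hmu l r)⟩
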